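/- Let $T$ be a non-empty string over a finite alphabet $\Sigma$ of size $\sigma$. The empty string is regarded as occurring at all $|T|+1$ positions of $T$. A substring $w$ of $T$ is a *maximal repeat* if it occurs more than once in $T$ and every left extension $aw$ and every right extension $wa$ ($a\in\Sigma$) occurs strictly fewer times in $T$ than $w$. Let $\mu_T$, $e_T^r$ and $e_T^\ell$ be the numbers of maximal repeats $w$ of $T$, of substrings of $T$ of the form $wa$, and of substrings of $T$ of the form $aw$, respectively, with $w$ a maximal repeat and $a\in\Sigma$. For a substring $x$ of $T$, let $\overrightarrow{x}$ be the longest string with the same beginning positions in $T$ as $x$, and let $[x]_R$ be the set of strings with the same ending positions in $T$ as $x$. $\mathrm{CDAWG}(T)$ is the edge-labeled DAG with nodes $[\overrightarrow{x}]_R$, for $x$ a substring of $T$, and edges $([y]_R,\, a\beta,\, [ya\beta]_R)$ for all $y=\overrightarrow{y}$, $a\in\Sigma$ and $\beta\in\Sigma^*$ such that $ya$ is a substring of $T$ and $\overrightarrow{ya}=ya\beta$; its source is $[\varepsilon]_R$. $\mathrm{L\text{-}CDAWG}(T)=(V,E)$ is obtained from it as follows. For each node $N$ of $\mathrm{CDAWG}(T)$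 with longest member $u$ and each $a\in\Sigma$ such that $au$ is a substring of $T$: if the path from the source spelling $au$ ends strictly inside an edge, a new node (of type 2) is inserted at that point. Each edge is split at the type-2 nodes inside it, and each resulting edge stores the first character and the length of its label. **Claim.** Over a constant alphabet, $|V| = O(\mu_T + e_T^r)$ and $|E| = O(e_T^r)$. That is, for every $\sigma$ there is a constant $C$ depending only on $\sigma$ such that, for every alphabet of size $\sigma$ and every non-empty string $T$ over it, $V$ and $E$ are finite, $|V|\le C(\mu_T+e_T^r)$ and $|E|\le C\,e_T^r$. Moreover, $e_T^\ell\le\sigma e_T^r$. -/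

import Mathlib

universe u

namespace LCDAWG

/-- Beginning positions (0-based) of the occurrences of `x` in `T`.  The empty string begins at
each of the positions `0, …, |T|`. -/
def begPos {A : Type*} [DecidableEq A] (T x : List A) : Finset ℕ :=
  (Finset.range (T.length + 1)).filter fun i => x <+: T.drop i

/-- Ending positions of the occurrences of `x` in `T`: the `i` such that `x` is a suffix of the
prefix of `T` of length `i`. -/
def endPos {A : Type*} [DecidableEq A] (T x : List A) : Finset ℕ :=
  (Finset.range (T.length + 1)).filter fun i => x <:+ T.take i

/-- The number of occurrences of `x` in `T`. -/
def numOcc {A : Type*} [DecidableEq A] (T x : List A) : ℕ :=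
  (begPos T x).card

/-- `w` is a maximal repeat of `T`: it occurs more than once, and all its left extensions `aw` and
right extensions `wa` occur strictly fewer times. -/
def IsMaximalRepeat {A : Type*} [DecidableEq A] (T w : List A) : Prop :=
  1 < numOcc T w ∧
  (∀ a : A, a :: w <:+: T → numOcc T (a :: w) < numOcc T w) ∧
  (∀ a : A, w ++ [a] <:+: T → numOcc T (w ++ [a]) < numOcc T w)

/-- The number of maximal repeats of `T`. -/
noncomputable def mu {A : Type*} [DecidableEq A] (T : List A) : ℕ :=
  {w : List A | IsMaximalRepeat T w}.ncard

/-- The number of right extensions of maximal repeats of `T`. -/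
noncomputable def eRight {A : Type*} [DecidableEq A] (T : List A) : ℕ :=
  {z : List A | z <:+: T ∧ ∃ w a, IsMaximalRepeat T w ∧ z = w ++ [a]}.ncard

/-- The number of left extensions of maximal repeats of `T`. -/
noncomputable def eLeft {A : Type*} [DecidableEq A] (T : List A) : ℕ :=
  {z : List A | z <:+: T ∧ ∃ w a, IsMaximalRepeat T w ∧ z = a :: w}.ncard

/-- `y` is the longest string with the same beginning positions in `T` as the substring `x`. -/
def IsLrep {A : Type*} [DecidableEq A] (T x y : List A) : Prop :=
  x <:+: T ∧ begPos T y = begPos T x ∧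
  ∀ z : List A, begPos T z = begPos T x → z.length ≤ y.length

/-- The class of the strings with the same ending positions in `T` as `x`. -/
def Rclass {A : Type*} [DecidableEq A] (T x : List A) : Set (List A) :=
  {y | endPos T y = endPos T x}

/-- The nodes of the CDAWG of `T`. -/
def cdawgV {A : Type*} [DecidableEq A] (T : List A) : Set (Set (List A)) :=
  {N | ∃ x y : List A, IsLrep T x y ∧ N = Rclass T y}

/-- An edge of a graph whose nodes are sets of strings and whose edge labels are strings. -/
@[ext] structure CEdge (A : Type*) where
  hi : Set (List A)
  lab : List A
  lo : Set (List A)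

/-- The edges of the CDAWG of `T`.  If `y` is the longest member of its `≡_L`-class and `ya` is a
substring of `T`, there is an edge from the class of `y`, whose label starts with `a`, such that
`y` followed by the label is the longest member of the `≡_L`-class of `ya`. -/
def cdawgE {A : Type*} [DecidableEq A] (T : List A) : Set (CEdge A) :=
  {e | ∃ (x y : List A) (a : A) (β : List A), IsLrep T x y ∧
      IsLrep T (y ++ [a]) (y ++ a :: β) ∧
      e.hi = Rclass T y ∧ e.lab = a :: β ∧ e.lo = Rclass T (y ++ a :: β)}

/-- `Spells T x N`: there is a path of the CDAWG of `T` from the source to `N` that spells out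
`x`. -/
inductive Spells {A : Type*} [DecidableEq A] (T : List A) : List A → Set (List A) → Prop
  | source : Spells T [] (Rclass T [])
  | step (x : List A) (e : CEdge A) (he : e ∈ cdawgE T) (hx : Spells T x e.hi) :
      Spells T (x ++ e.lab) e.lo

/-- The path of the CDAWG of `T` from the source that spells out `s` ends strictly inside the edge
`e`, after the first `k` characters of its label. -/
def EndsInside {A : Type*} [DecidableEq A] (T s : List A) (e : CEdge A) (k : ℕ) : Prop :=
  e ∈ cdawgE T ∧ 0 < k ∧ k < e.lab.length ∧
  ∃ x : List A, Spells T x e.hi ∧ s = x ++ e.lab.take k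

/-- `u` is the value (the longest member) of the node `N`. -/
def IsValue {A : Type*} (N : Set (List A)) (u : List A) : Prop :=
  u ∈ N ∧ ∀ v ∈ N, v.length ≤ u.length

/-- There is a type-2 node inside the edge `e` after the first `k` characters of its label: the
path that spells out some substring `au` of `T`, where `u` is the value of a CDAWG node, ends
there. -/
def IsType2 {A : Type*} [DecidableEq A] (T : List A) (e : CEdge A) (k : ℕ) : Prop :=
  ∃ N ∈ cdawgV T, ∃ (u : List A) (a : A),
    IsValue N u ∧ a :: u <:+: T ∧ EndsInside T (a :: u) e k

/-- Nodes of the L-CDAWG: a node of the CDAWG (type 1), or a point inside an edge of the CDAWG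
(type 2). -/
inductive LNode (A : Type*)
  | type1 (N : Set (List A)) : LNode A
  | type2 (e : CEdge A) (k : ℕ) : LNode A

/-- The node set of the L-CDAWG of `T`. -/
def V {A : Type*} [DecidableEq A] (T : List A) : Set (LNode A) :=
  {v | (∃ N ∈ cdawgV T, v = LNode.type1 N) ∨ ∃ e k, IsType2 T e k ∧ v = LNode.type2 e k}

/-- An edge of the L-CDAWG: its end points, the first character of its original label, and the
length of that label. -/
@[ext] structure LEdge (A : Type*) where
  hi : LNode A
  char : A
  slen : ℕ
  lo : LNode A

/-- `IsPoint T e k v`: `v` is the L-CDAWG node on the CDAWG edge `e` after the first `k` characters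
of its label. -/
def IsPoint {A : Type*} [DecidableEq A] (T : List A) (e : CEdge A) (k : ℕ) (v : LNode A) : Prop :=
  (k = 0 ∧ v = LNode.type1 e.hi) ∨
  (k = e.lab.length ∧ v = LNode.type1 e.lo) ∨
  (IsType2 T e k ∧ v = LNode.type2 e k)

/-- The edge set of the L-CDAWG of `T`: each CDAWG edge is split at the type-2 nodes inside it, and
an edge joins any two consecutive nodes on it. -/
def E {A : Type*} [DecidableEq A] (T : List A) : Set (LEdge A) :=
  {f | ∃ e ∈ cdawgE T, ∃ i j : ℕ, i < j ∧
      IsPoint T e i f.hi ∧ IsPoint T e j f.lo ∧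
      (∀ k v, i < k → k < j → ¬ IsPoint T e k v) ∧
      e.lab[i]? = some f.char ∧ f.slen = j - i}

end LCDAWG

/-! Call `x` right-maximal if every right extension of `x` occurs fewer times than `x`; the strings
`y = →y` are exactly these. The longest string with the same ending positions as a right-maximal
string is a maximal repeat, unless it occurs only once, and then it is `T`. So there are at most
`μ + 1` nodes. The edges leaving the node of `u` have distinct first characters `a`, and `ua` then
occurs in `T`, which rules out `u = T`: the edges inject into the right extensions `ua` of maximal
repeats.

No string that ends strictly inside an edge is right-maximal, because the number of occurrences is
constant along the edge after its first character, whereas every path from the source to a node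
spells a right-maximal string. Hence the node at which `s` enters the edge containing its end point
is that of the longest right-maximal prefix of `s`, so the end point is determined by `s`, and the
type-2 nodes inject into the left extensions of maximal repeats. Their number is at most `σ μ`, and
`μ ≤ e^r` because a maximal repeat has an occurrence that is not at the end of `T`.
-/

namespace LCDAWG

theorem encard_le_encard_of_forall_subsingleton {α β : Type*} {s : Set α} {t : Set β}
    (r : α → β → Prop) (hs : ∀ x ∈ s, ∃ y ∈ t, r x y)
    (ht : ∀ y ∈ t, {x ∈ s | r x y}.Subsingleton) : s.encard ≤ t.encard := by
  rcases s.eq_empty_or_nonempty with rfl | ⟨x₀, hx₀⟩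
  · simp
  have : Nonempty β := (hs x₀ hx₀).nonempty
  choose! f hft hfr using hs
  refine Set.encard_le_encard_of_injOn (f := f) hft fun x hx x' hx' h => ?_
  exact ht (f x) (hft x hx) ⟨hx, hfr x hx⟩ ⟨hx', h ▸ hfr x' hx'⟩

theorem finite_setOf_isInfix {A : Type*} (T : List A) : {x : List A | x <:+: T}.Finite := by
  classical
  exact T.sublists.toFinset.finite_toSet.subset fun x (hx : x <:+: T) => by
    simpa using hx.sublist

section

variable {A : Type*} [DecidableEq A] {T x y z u v w s : List A} {i k k' : ℕ}

theorem mem_begPos : i ∈ begPos T x ↔ ∃ p, p ++ x <+: T ∧ p.length = i := by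
  simp only [begPos, Finset.mem_filter, Finset.mem_range, Nat.lt_succ_iff]
  constructor
  · rintro ⟨hi, hx⟩
    refine ⟨T.take i, ?_, List.length_take_of_le hi⟩
    simpa only [List.take_append_drop] using (List.prefix_append_right_inj (T.take i)).2 hx
  · rintro ⟨p, ⟨s, rfl⟩, rfl⟩
    simp

theorem mem_endPos : i ∈ endPos T x ↔ ∃ p, x <:+ p ∧ p <+: T ∧ p.length = i := by
  simp only [endPos, Finset.mem_filter, Finset.mem_range, Nat.lt_succ_iff]
  constructor
  · rintro ⟨hi, hx⟩
    exact ⟨T.take i, hx, List.take_prefix i T, List.length_take_of_le hi⟩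
  · rintro ⟨p, hx, hp, rfl⟩
    exact ⟨hp.length_le, by rwa [← List.prefix_iff_eq_take.1 hp]⟩

theorem mem_endPos_append :
    i ∈ endPos T (x ++ y) ↔ ∃ q, q.length ∈ endPos T x ∧ q ++ y <+: T ∧ (q ++ y).length = i := by
  rw [mem_endPos]
  constructor
  · rintro ⟨_, ⟨p, rfl⟩, hT, rfl⟩
    rw [← List.append_assoc] at hT ⊢
    have hx : (p ++ x).length ∈ endPos T x :=
      mem_endPos.2 ⟨_, List.suffix_append p x, (List.prefix_append _ y).trans hT, rfl⟩
    exact ⟨p ++ x, hx, hT, rfl⟩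
  · rintro ⟨q, hq, hT, rfl⟩
    obtain ⟨p, hxp, hpT, hlen⟩ := mem_endPos.1 hq
    obtain rfl : p = q := (List.prefix_of_prefix_length_le hpT
      ((List.prefix_append q y).trans hT) hlen.le).eq_of_length hlen
    exact ⟨p ++ y, List.suffix_append_self_iff.2 hxp, hT, rfl⟩

theorem endPos_append_congr (h : endPos T x = endPos T y) (v : List A) :
    endPos T (x ++ v) = endPos T (y ++ v) := by
  ext i
  rw [mem_endPos_append, mem_endPos_append, h]

theorem endPos_eq_image_begPos (T x : List A) :
    endPos T x = (begPos T x).image (· + x.length) := by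
  ext i
  simp only [mem_endPos, Finset.mem_image, mem_begPos]
  constructor
  · rintro ⟨_, ⟨p, rfl⟩, hT, rfl⟩
    exact ⟨p.length, ⟨p, hT, rfl⟩, List.length_append.symm⟩
  · rintro ⟨_, ⟨p, hT, rfl⟩, rfl⟩
    exact ⟨p ++ x, List.suffix_append p x, hT, List.length_append⟩

theorem card_endPos (T x : List A) : (endPos T x).card = numOcc T x := by
  rw [endPos_eq_image_begPos, Finset.card_image_of_injective _ (add_left_injective _), numOcc]

theorem numOcc_congr (h : endPos T x = endPos T y) : numOcc T x = numOcc T y := by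
  rw [← card_endPos, ← card_endPos, h]

theorem begPos_nonempty : (begPos T x).Nonempty ↔ x <:+: T := by
  constructor
  · rintro ⟨i, hi⟩
    obtain ⟨p, hT, -⟩ := mem_begPos.1 hi
    exact (List.suffix_append p x).isInfix.trans hT.isInfix
  · rintro ⟨p, s, rfl⟩
    exact ⟨p.length, mem_begPos.2 ⟨p, List.prefix_append _ s, rfl⟩⟩

theorem endPos_nonempty : (endPos T x).Nonempty ↔ x <:+: T := by
  rw [endPos_eq_image_begPos, Finset.image_nonempty, begPos_nonempty]

theorem numOcc_pos : 0 < numOcc T x ↔ x <:+: T := by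
  rw [numOcc, Finset.card_pos, begPos_nonempty]

theorem isInfix_congr (h : endPos T x = endPos T y) : x <:+: T ↔ y <:+: T := by
  rw [← endPos_nonempty, h, endPos_nonempty]

theorem begPos_subset_of_isPrefix (h : x <+: y) : begPos T y ⊆ begPos T x :=
  Finset.monotone_filter_right _ fun _ _ hy => h.trans hy

theorem endPos_subset_of_isSuffix (h : x <:+ y) : endPos T y ⊆ endPos T x :=
  Finset.monotone_filter_right _ fun _ _ hy => h.trans hy

theorem numOcc_le_of_isPrefix (h : x <+: y) : numOcc T y ≤ numOcc T x :=
  Finset.card_le_card (begPos_subset_of_isPrefix h)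

theorem isPrefix_of_mem_begPos (hx : i ∈ begPos T x) (hy : i ∈ begPos T y)
    (h : x.length ≤ y.length) : x <+: y :=
  List.prefix_of_prefix_length_le (Finset.mem_filter.1 hx).2 (Finset.mem_filter.1 hy).2 h

theorem endPos_self (T : List A) : endPos T T = {T.length} := by
  ext i
  rw [mem_endPos, Finset.mem_singleton]
  constructor
  · rintro ⟨p, hTp, hpT, rfl⟩
    exact le_antisymm hpT.length_le hTp.length_le
  · rintro rfl
    exact ⟨T, List.suffix_rfl, List.prefix_rfl, rfl⟩

theorem exists_append_singleton_isInfix_of_mem_endPos (hi : i ∈ endPos T x) (hne : i ≠ T.length) :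
    ∃ a, x ++ [a] <:+: T := by
  obtain ⟨p, hx, hp, rfl⟩ := mem_endPos.1 hi
  have hlt : p.length < T.length := lt_of_le_of_ne hp.length_le hne
  refine ⟨T[p.length], (List.suffix_append_self_iff.2 hx).isInfix.trans ?_⟩
  exact (List.concat_get_prefix hp hlt).isInfix

/-- `x` is right-maximal in `T`: each string `xa`, whether or not it occurs in `T`, has fewer
occurrences than `x`. By `isLrep_append_iff` these are the strings `y = →y`. -/
def RightMaximal {A : Type*} [DecidableEq A] (T x : List A) : Prop :=
  ∀ a : A, numOcc T (x ++ [a]) < numOcc T x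

theorem RightMaximal.congr (hx : RightMaximal T x) (h : endPos T x = endPos T y) :
    RightMaximal T y := fun a => by
  rw [← numOcc_congr h, ← numOcc_congr (endPos_append_congr h [a])]
  exact hx a

theorem RightMaximal.isInfix (hx : RightMaximal T x) : x <:+: T := by
  cases x with
  | nil => exact List.nil_infix
  | cons a x => exact numOcc_pos.1 (Nat.zero_lt_of_lt (hx a))

theorem numOcc_singleton_lt (T : List A) (a : A) : numOcc T [a] < numOcc T [] := by
  refine Finset.card_lt_card ⟨begPos_subset_of_isPrefix List.nil_prefix, fun hsub => ?_⟩
  have hmem : T.length ∈ begPos T [] := mem_begPos.2 ⟨T, by simp, rfl⟩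
  obtain ⟨p, hpT, hp⟩ := mem_begPos.1 (hsub hmem)
  have hle := hpT.length_le
  rw [List.length_append, List.length_singleton] at hle
  omega

theorem rightMaximal_nil (T : List A) : RightMaximal T [] :=
  numOcc_singleton_lt T

theorem isMaximalRepeat_nil (hT : T ≠ []) : IsMaximalRepeat T [] := by
  have hpos : 0 < T.length := List.length_pos_iff.2 hT
  have hocc : numOcc T [] = T.length + 1 := by simp [numOcc, begPos]
  exact ⟨by omega, fun a _ => numOcc_singleton_lt T a, fun a _ => numOcc_singleton_lt T a⟩

theorem IsMaximalRepeat.isInfix (h : IsMaximalRepeat T w) : w <:+: T :=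
  numOcc_pos.1 (zero_lt_one.trans h.1)

theorem finite_setOf_isMaximalRepeat (T : List A) : {w : List A | IsMaximalRepeat T w}.Finite :=
  (finite_setOf_isInfix T).subset fun _ h => IsMaximalRepeat.isInfix h

theorem IsMaximalRepeat.exists_append_singleton_isInfix (h : IsMaximalRepeat T w) :
    ∃ a, w ++ [a] <:+: T := by
  have hcard : 1 < (endPos T w).card := by
    rw [card_endPos]
    exact h.1
  obtain ⟨i, hi, hne⟩ := Finset.exists_mem_ne hcard T.length
  exact exists_append_singleton_isInfix_of_mem_endPos hi hne

theorem one_le_mu (hT : T ≠ []) : 1 ≤ mu T :=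
  (Set.ncard_pos (finite_setOf_isMaximalRepeat T)).2 ⟨[], isMaximalRepeat_nil hT⟩

theorem cast_mu (T : List A) : (mu T : ℕ∞) = {w : List A | IsMaximalRepeat T w}.encard :=
  (finite_setOf_isMaximalRepeat T).cast_ncard_eq

theorem cast_eRight (T : List A) : (eRight T : ℕ∞) =
    {z : List A | z <:+: T ∧ ∃ w a, IsMaximalRepeat T w ∧ z = w ++ [a]}.encard :=
  ((finite_setOf_isInfix T).subset fun _ hz => hz.1).cast_ncard_eq

theorem cast_eLeft (T : List A) : (eLeft T : ℕ∞) =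
    {z : List A | z <:+: T ∧ ∃ w a, IsMaximalRepeat T w ∧ z = a :: w}.encard :=
  ((finite_setOf_isInfix T).subset fun _ hz => hz.1).cast_ncard_eq

theorem mu_le_eRight (T : List A) : mu T ≤ eRight T := by
  have hfin := (finite_setOf_isInfix T).subset
    fun z (hz : z <:+: T ∧ ∃ w a, IsMaximalRepeat T w ∧ z = w ++ [a]) => hz.1
  refine (Set.ncard_le_ncard (fun w hw => ?_) (hfin.image List.dropLast)).trans
    (Set.ncard_image_le hfin)
  obtain ⟨a, ha⟩ := IsMaximalRepeat.exists_append_singleton_isInfix hw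
  exact ⟨w ++ [a], ⟨ha, w, a, hw, rfl⟩, List.dropLast_concat⟩

theorem eLeft_le_card_toFinset_mul_mu (T : List A) : eLeft T ≤ T.toFinset.card * mu T := by
  have hfin := T.toFinset.finite_toSet.prod (finite_setOf_isMaximalRepeat T)
  rw [mu, ← Set.ncard_coe_finset, ← Set.ncard_prod]
  refine (Set.ncard_le_ncard ?_ (hfin.image fun q => q.1 :: q.2)).trans (Set.ncard_image_le hfin)
  rintro _ ⟨hT, w, a, hw, rfl⟩
  exact ⟨(a, w), ⟨List.mem_toFinset.2 (hT.subset List.mem_cons_self), hw⟩, rfl⟩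

theorem IsLrep.numOcc_eq (h : IsLrep T x y) : numOcc T y = numOcc T x :=
  congrArg Finset.card h.2.1

theorem IsLrep.rightMaximal (h : IsLrep T x y) : RightMaximal T y := fun a => by
  have hsub := begPos_subset_of_isPrefix (T := T) (List.prefix_append y [a])
  refine Finset.card_lt_card (hsub.ssubset_of_ne fun heq => ?_)
  simpa using h.2.2 (y ++ [a]) (heq.trans h.2.1)

theorem isLrep_append_iff :
    IsLrep T x (x ++ v) ↔ numOcc T (x ++ v) = numOcc T x ∧ RightMaximal T (x ++ v) := by
  refine ⟨fun h => ⟨h.numOcc_eq, h.rightMaximal⟩, fun ⟨hocc, hmax⟩ => ?_⟩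
  have hx : x <:+: T := (List.prefix_append x v).isInfix.trans hmax.isInfix
  have hbeg : begPos T (x ++ v) = begPos T x :=
    Finset.eq_of_subset_of_card_le (begPos_subset_of_isPrefix (List.prefix_append x v)) hocc.ge
  refine ⟨hx, hbeg, fun z hz => ?_⟩
  by_contra! hlt
  obtain ⟨i, hi⟩ := begPos_nonempty.2 hx
  have hpre : x ++ v <+: z := isPrefix_of_mem_begPos (hbeg ▸ hi) (hz ▸ hi) hlt.le
  exact lt_irrefl (numOcc T z) <| calc
    numOcc T z ≤ numOcc T (x ++ v ++ [z[(x ++ v).length]]) :=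
      numOcc_le_of_isPrefix (List.concat_get_prefix hpre hlt)
    _ < numOcc T (x ++ v) := hmax _
    _ = numOcc T z := congrArg Finset.card (hbeg.trans hz.symm)

theorem IsLrep.append_congr (h : IsLrep T (x ++ u) (x ++ u ++ v))
    (hxy : endPos T x = endPos T y) : IsLrep T (y ++ u) (y ++ u ++ v) := by
  have hu := endPos_append_congr hxy u
  have hv := endPos_append_congr hu v
  obtain ⟨hocc, hmax⟩ := isLrep_append_iff.1 h
  refine isLrep_append_iff.2 ⟨?_, hmax.congr hv⟩
  rw [← numOcc_congr hu, ← numOcc_congr hv, hocc]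

theorem IsLrep.unique (hy : IsLrep T x y) (hz : IsLrep T x z) : y = z := by
  have hlen : y.length = z.length := le_antisymm (hz.2.2 y hy.2.1) (hy.2.2 z hz.2.1)
  obtain ⟨i, hi⟩ := begPos_nonempty.2 hy.1
  exact (isPrefix_of_mem_begPos (hy.2.1 ▸ hi) (hz.2.1 ▸ hi) hlen.le).eq_of_length hlen

theorem IsLrep.eq_of_rightMaximal (h : IsLrep T x z) (hxy : x <+: y) (hyz : y <+: z)
    (hy : RightMaximal T y) : y = z := by
  refine hyz.eq_of_length_le (not_lt.1 fun hlt => lt_irrefl (numOcc T z) ?_)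
  calc
    numOcc T z ≤ numOcc T (y ++ [z[y.length]]) :=
      numOcc_le_of_isPrefix (List.concat_get_prefix hyz hlt)
    _ < numOcc T y := hy _
    _ ≤ numOcc T x := numOcc_le_of_isPrefix hxy
    _ = numOcc T z := h.numOcc_eq.symm

theorem rclass_eq_rclass_iff : Rclass T x = Rclass T y ↔ endPos T x = endPos T y := by
  refine ⟨fun h => ?_, fun h => by simp only [Rclass, h]⟩
  have hx : x ∈ Rclass T y := h ▸ rfl
  exact hx

theorem exists_isValue_rclass (hy : y <:+: T) : ∃ u, IsValue (Rclass T y) u := by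
  have hfin : (Rclass T y).Finite :=
    (finite_setOf_isInfix T).subset fun _ hz => (isInfix_congr hz).2 hy
  obtain ⟨u, hu, hmax⟩ := hfin.exists_maximalFor List.length _ ⟨y, rfl⟩
  exact ⟨u, hu, fun v hv => (le_total v.length u.length).elim id (hmax hv)⟩

theorem RightMaximal.endPos_eq_singleton (hx : RightMaximal T x) (h : numOcc T x ≤ 1) :
    endPos T x = {T.length} := by
  refine Finset.eq_singleton_iff_nonempty_unique_mem.2
    ⟨endPos_nonempty.2 hx.isInfix, fun i hi => by_contra fun hne => ?_⟩
  obtain ⟨a, ha⟩ := exists_append_singleton_isInfix_of_mem_endPos hi hne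
  exact ((numOcc_pos.2 ha).trans_le (Nat.lt_succ_iff.1 ((hx a).trans_le h))).false

theorem exists_rightMaximal_of_mem_cdawgV {N : Set (List A)} (hN : N ∈ cdawgV T) :
    ∃ y, RightMaximal T y ∧ N = Rclass T y := by
  obtain ⟨_, y, hy, rfl⟩ := hN
  exact ⟨y, hy.rightMaximal, rfl⟩

theorem IsValue.eq_or_isMaximalRepeat {N : Set (List A)} (hN : N ∈ cdawgV T) (hu : IsValue N u) :
    u = T ∨ IsMaximalRepeat T u := by
  obtain ⟨y, hy, rfl⟩ := exists_rightMaximal_of_mem_cdawgV hN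
  have hend : endPos T u = endPos T y := hu.1
  have hmax : RightMaximal T u := hy.congr hend.symm
  rcases lt_or_ge 1 (numOcc T u) with hrep | honce
  · refine Or.inr ⟨hrep, fun a _ => ?_, fun a _ => hmax a⟩
    rw [← card_endPos, ← card_endPos]
    have hsub := endPos_subset_of_isSuffix (T := T) (List.suffix_cons a u)
    refine Finset.card_lt_card (hsub.ssubset_of_ne fun heq => ?_)
    simpa using hu.2 (a :: u) (heq.trans hend)
  · have hT : T ∈ Rclass T y :=
      (endPos_self T).trans ((hmax.endPos_eq_singleton honce).symm.trans hend)
    exact Or.inl (hmax.isInfix.eq_of_length_le (hu.2 T hT))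

theorem exists_eq_rclass_of_mem_cdawgV {N : Set (List A)} (hN : N ∈ cdawgV T) :
    ∃ u, (u = T ∨ IsMaximalRepeat T u) ∧ N = Rclass T u := by
  obtain ⟨y, hy, rfl⟩ := exists_rightMaximal_of_mem_cdawgV hN
  obtain ⟨u, hu⟩ := exists_isValue_rclass hy.isInfix
  exact ⟨u, hu.eq_or_isMaximalRepeat hN, rclass_eq_rclass_iff.2 hu.1.symm⟩

theorem encard_cdawgV_le (T : List A) : (cdawgV T).encard ≤ mu T + 1 := by
  have hsub : cdawgV T ⊆ Rclass T '' insert T {w | IsMaximalRepeat T w} := fun N hN => by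
    obtain ⟨u, hu, rfl⟩ := exists_eq_rclass_of_mem_cdawgV hN
    exact ⟨u, hu, rfl⟩
  grw [hsub, Set.encard_image_le, Set.encard_insert_le, cast_mu]

/-- `cdawgE` describes an edge through one representative of its upper node; here `x` may be any
other, such as the string spelled by a path to that node. -/
theorem exists_eq_mk_of_mem_cdawgE {e : CEdge A} (he : e ∈ cdawgE T) (hx : e.hi = Rclass T x) :
    ∃ a β, e = ⟨Rclass T x, a :: β, Rclass T (x ++ a :: β)⟩ ∧
      IsLrep T (x ++ [a]) (x ++ a :: β) := by
  obtain ⟨_, y, a, β, -, h, hhi, hlab, hlo⟩ := he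
  have hyx : endPos T y = endPos T x := rclass_eq_rclass_iff.1 (hhi.symm.trans hx)
  refine ⟨a, β, CEdge.ext hx hlab (hlo.trans ?_), ?_⟩
  · exact rclass_eq_rclass_iff.2 (endPos_append_congr hyx _)
  · simp only [List.append_cons _ a β] at h ⊢
    exact h.append_congr hyx

theorem hi_mem_cdawgV {e : CEdge A} (he : e ∈ cdawgE T) : e.hi ∈ cdawgV T := by
  obtain ⟨x, y, _, _, hy, -, hhi, -⟩ := he
  exact ⟨x, y, hy, hhi⟩

theorem lab_length_pos {e : CEdge A} (he : e ∈ cdawgE T) : 0 < e.lab.length := by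
  obtain ⟨_, _, a, β, -, -, -, hlab, -⟩ := he
  rw [hlab]
  exact Nat.succ_pos _

theorem eq_of_mem_cdawgE {e e' : CEdge A} (he : e ∈ cdawgE T) (he' : e' ∈ cdawgE T)
    (hhi : e.hi = e'.hi) (hhead : e.lab.head? = e'.lab.head?) : e = e' := by
  obtain ⟨y, -, hy⟩ := exists_rightMaximal_of_mem_cdawgV (hi_mem_cdawgV he)
  obtain ⟨a, β, rfl, h⟩ := exists_eq_mk_of_mem_cdawgE he hy
  obtain ⟨a', β', rfl, h'⟩ := exists_eq_mk_of_mem_cdawgE he' (hhi.symm.trans hy)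
  obtain rfl : a = a' := Option.some.inj hhead
  rw [List.append_cancel_left (h.unique h')]

theorem encard_cdawgE_le (T : List A) : (cdawgE T).encard ≤ eRight T := by
  rw [cast_eRight]
  refine encard_le_encard_of_forall_subsingleton
    (fun e z => ∃ u a, e.hi = Rclass T u ∧ e.lab.head? = some a ∧ z = u ++ [a]) ?_ ?_
  · intro e he
    obtain ⟨u, hu, hhi⟩ := exists_eq_rclass_of_mem_cdawgV (hi_mem_cdawgV he)
    obtain ⟨a, β, rfl, h⟩ := exists_eq_mk_of_mem_cdawgE he hhi
    have hne : u ≠ T := by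
      rintro rfl
      simpa using h.1.length_le
    exact ⟨u ++ [a], ⟨h.1, u, a, hu.resolve_left hne, rfl⟩, u, a, rfl, rfl, rfl⟩
  · rintro _ - e ⟨he, u, a, hhi, hhead, rfl⟩ e' ⟨he', u', a', hhi', hhead', h⟩
    obtain ⟨rfl, ha⟩ := List.append_inj' h rfl
    obtain rfl : a = a' := List.singleton_injective ha
    exact eq_of_mem_cdawgE he he' (hhi.trans hhi'.symm) (hhead.trans hhead'.symm)

theorem Spells.eq_rclass_and_rightMaximal {N : Set (List A)} (h : Spells T x N) :
    N = Rclass T x ∧ RightMaximal T x := by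
  induction h with
  | source => exact ⟨rfl, rightMaximal_nil T⟩
  | step x e he _ ih =>
    obtain ⟨a, β, rfl, h⟩ := exists_eq_mk_of_mem_cdawgE he ih.1
    exact ⟨rfl, h.rightMaximal⟩

theorem RightMaximal.length_le_of_isPrefix_append_take {e : CEdge A} (hz : RightMaximal T z)
    (he : e ∈ cdawgE T) (hx : e.hi = Rclass T x) (hk : k < e.lab.length)
    (hpre : z <+: x ++ e.lab.take k) : z.length ≤ x.length := by
  obtain ⟨a, β, rfl, h⟩ := exists_eq_mk_of_mem_cdawgE he hx
  by_contra! hlt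
  have hz_edge : z <+: x ++ a :: β :=
    hpre.trans ((List.prefix_append_right_inj x).2 (List.take_prefix k _))
  have hx_edge : x ++ [a] <+: x ++ a :: β := ⟨β, by simp⟩
  have hxz : x ++ [a] <+: z := List.prefix_of_prefix_length_le hx_edge hz_edge (by simpa using hlt)
  have hlen := hpre.length_le
  rw [h.eq_of_rightMaximal hxz hz_edge hz, List.length_append, List.length_append,
    List.length_take] at hlen
  dsimp only at hk hlen
  omega

theorem EndsInside.unique {e e' : CEdge A} (h : EndsInside T s e k) (h' : EndsInside T s e' k') :
    e = e' ∧ k = k' := by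
  obtain ⟨he, hpos, hk, x, hx, hs⟩ := h
  obtain ⟨he', -, hk', x', hx', hs'⟩ := h'
  obtain ⟨hhi, hmax⟩ := hx.eq_rclass_and_rightMaximal
  obtain ⟨hhi', hmax'⟩ := hx'.eq_rclass_and_rightMaximal
  have hlen : x.length = x'.length := le_antisymm
    (hmax.length_le_of_isPrefix_append_take he' hhi' hk' ⟨_, hs.symm.trans hs'⟩)
    (hmax'.length_le_of_isPrefix_append_take he hhi hk ⟨_, hs'.symm.trans hs⟩)
  obtain ⟨rfl, htake⟩ := List.append_inj (hs.symm.trans hs') hlen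
  obtain rfl : k = k' := by
    simpa only [List.length_take_of_le hk.le, List.length_take_of_le hk'.le]
      using congrArg List.length htake
  have hhead := congrArg List.head? htake
  simp only [List.head?_take, hpos.ne', if_false] at hhead
  exact ⟨eq_of_mem_cdawgE he he' (hhi.trans hhi'.symm) hhead, rfl⟩

theorem encard_isType2_le (T : List A) :
    {q : CEdge A × ℕ | IsType2 T q.1 q.2}.encard ≤ eLeft T := by
  rw [cast_eLeft]
  refine encard_le_encard_of_forall_subsingleton (fun q z => EndsInside T z q.1 q.2) ?_ ?_
  · rintro ⟨e, k⟩ ⟨N, hN, u, a, hu, hau, hend⟩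
    have hne : u ≠ T := by
      rintro rfl
      simpa using hau.length_le
    have hrep := (hu.eq_or_isMaximalRepeat hN).resolve_left hne
    exact ⟨a :: u, ⟨hau, u, a, hrep, rfl⟩, hend⟩
  · rintro z - q ⟨-, h⟩ q' ⟨-, h'⟩
    exact Prod.ext (h.unique h').1 (h.unique h').2

theorem encard_V_le (T : List A) : (V T).encard ≤ mu T + 1 + eLeft T := by
  have hsub : V T ⊆ LNode.type1 '' cdawgV T ∪
      (fun q : CEdge A × ℕ => LNode.type2 q.1 q.2) '' {q | IsType2 T q.1 q.2} := by
    rintro v (⟨N, hN, rfl⟩ | ⟨e, k, h, rfl⟩)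
    · exact Or.inl ⟨N, hN, rfl⟩
    · exact Or.inr ⟨(e, k), h, rfl⟩
  grw [hsub, Set.encard_union_le, Set.encard_image_le, Set.encard_image_le, encard_cdawgV_le,
    encard_isType2_le]

theorem IsType2.pos_and_lt {e : CEdge A} (h : IsType2 T e k) : 0 < k ∧ k < e.lab.length := by
  obtain ⟨_, -, _, _, -, -, -, hpos, hlt, -⟩ := h
  exact ⟨hpos, hlt⟩

theorem IsPoint.le_length {e : CEdge A} {n : LNode A} (h : IsPoint T e k n) :
    k ≤ e.lab.length := by
  rcases h with ⟨rfl, -⟩ | ⟨rfl, -⟩ | ⟨h, -⟩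
  · exact Nat.zero_le _
  · exact le_rfl
  · exact h.pos_and_lt.2.le

theorem IsPoint.unique {e : CEdge A} {n n' : LNode A} (he : e ∈ cdawgE T) (h : IsPoint T e k n)
    (h' : IsPoint T e k n') : n = n' := by
  have hpos := lab_length_pos he
  have hinner : IsType2 T e k → 0 < k ∧ k < e.lab.length := IsType2.pos_and_lt
  rcases h with ⟨hk, rfl⟩ | ⟨hk, rfl⟩ | ⟨ht, rfl⟩ <;>
    rcases h' with ⟨hk', rfl⟩ | ⟨hk', rfl⟩ | ⟨ht', rfl⟩ <;> grind

/-- `f` is the piece of the CDAWG edge `e` that starts after the first `i` characters of its label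
and ends at the next node on `e`. The edges of the L-CDAWG are these pieces, indexed here by the
pairs `(e, i)` so that they can be counted. -/
def IsSegment {A : Type*} [DecidableEq A] (T : List A) (e : CEdge A) (i : ℕ) (f : LEdge A) :
    Prop :=
  ∃ j, i < j ∧ IsPoint T e i f.hi ∧ IsPoint T e j f.lo ∧
    (∀ k n, i < k → k < j → ¬ IsPoint T e k n) ∧ e.lab[i]? = some f.char ∧ f.slen = j - i

theorem IsSegment.eq_zero_or_isType2 {e : CEdge A} {f : LEdge A} (h : IsSegment T e i f) :
    i = 0 ∨ IsType2 T e i := by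
  obtain ⟨j, hij, ⟨hi, -⟩ | ⟨rfl, -⟩ | ⟨hi, -⟩, hj, -⟩ := h
  · exact Or.inl hi
  · exact absurd hj.le_length hij.not_ge
  · exact Or.inr hi

theorem IsSegment.unique {e : CEdge A} {f f' : LEdge A} (he : e ∈ cdawgE T)
    (h : IsSegment T e i f) (h' : IsSegment T e i f') : f = f' := by
  obtain ⟨j, hij, hhi, hlo, hbetween, hchar, hlen⟩ := h
  obtain ⟨j', hij', hhi', hlo', hbetween', hchar', hlen'⟩ := h'
  obtain rfl : j = j' := le_antisymm
    (not_lt.1 fun hlt => hbetween j' _ hij' hlt hlo')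
    (not_lt.1 fun hlt => hbetween' j _ hij hlt hlo)
  exact LEdge.ext (hhi.unique he hhi') (Option.some.inj (hchar.symm.trans hchar'))
    (hlen.trans hlen'.symm) (hlo.unique he hlo')

theorem encard_E_le (T : List A) : (E T).encard ≤ eRight T + eLeft T := by
  have hsegment : (E T).encard ≤
      ((·, 0) '' cdawgE T ∪ {q : CEdge A × ℕ | IsType2 T q.1 q.2}).encard := by
    refine encard_le_encard_of_forall_subsingleton
      (fun f q => q.1 ∈ cdawgE T ∧ IsSegment T q.1 q.2 f) ?_ ?_
    · rintro f ⟨e, he, i, hf⟩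
      refine ⟨(e, i), ?_, he, hf⟩
      rcases IsSegment.eq_zero_or_isType2 hf with rfl | hi
      · exact Or.inl ⟨e, he, rfl⟩
      · exact Or.inr hi
    · rintro q - f ⟨-, he, hf⟩ f' ⟨-, -, hf'⟩
      exact hf.unique he hf'
  grw [hsegment, Set.encard_union_le, Set.encard_image_le, encard_cdawgE_le, encard_isType2_le]

end

end LCDAWG

open LCDAWG in
theorem mainTheorem8_general {A : Type*} [DecidableEq A] {T : List A} {σ : ℕ} (hT : T ≠ [])
    (hσ : T.toFinset.card ≤ σ) :
    (V T).Finite ∧ (E T).Finite ∧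
    (V T).ncard ≤ (σ + 1) * (mu T + eRight T) ∧
    (E T).ncard ≤ (σ + 1) * eRight T ∧
    eLeft T ≤ σ * eRight T := by
  have hmu : 1 ≤ mu T := one_le_mu hT
  have hright : mu T ≤ eRight T := mu_le_eRight T
  have hleft : eLeft T ≤ σ * eRight T :=
    (eLeft_le_card_toFinset_mul_mu T).trans (Nat.mul_le_mul hσ hright)
  obtain ⟨hVfin, hV⟩ : (V T).Finite ∧ (V T).ncard ≤ mu T + 1 + eLeft T :=
    Set.encard_le_coe_iff_finite_ncard_le.1 (mod_cast encard_V_le T)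
  obtain ⟨hEfin, hE⟩ : (E T).Finite ∧ (E T).ncard ≤ eRight T + eLeft T :=
    Set.encard_le_coe_iff_finite_ncard_le.1 (mod_cast encard_E_le T)
  refine ⟨hVfin, hEfin, ?_, ?_, hleft⟩
  · nlinarith [Nat.zero_le (σ * mu T)]
  · linarith

theorem mainTheorem8 (σ : ℕ) :
    ∃ C : ℕ, ∀ (A : Type u) [Fintype A] [DecidableEq A], Fintype.card A = σ →
      ∀ T : List A, T ≠ [] →
        (LCDAWG.V T).Finite ∧ (LCDAWG.E T).Finite ∧
        (LCDAWG.V T).ncard ≤ C * (LCDAWG.mu T + LCDAWG.eRight T) ∧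
        (LCDAWG.E T).ncard ≤ C * LCDAWG.eRight T ∧
        LCDAWG.eLeft T ≤ σ * LCDAWG.eRight T := by
  exact ⟨σ + 1, fun A _ _ hA T hT => mainTheorem8_general hT (hA ▸ T.toFinset.card_le_univ)⟩
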